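/- Conventions. A map $\varphi:\mathbb R^m\to\mathbb R^n$ is quadratic if all its components are homogeneous polynomials of degree $2$ (or zero) in the coordinates. A smooth map $\varphi: M\to N$ of Riemannian manifolds is a harmonic morphism if for every open $V\subset N$ and every harmonic function $f:V\to\mathbb R$ the function $f\circ\varphi$ is harmonic on $\varphi^{-1}(V)$. A quadratic harmonic morphism is a non-constant quadratic map that is a harmonic morphism. A Clifford system $(P_0,P_1,P_2)$ on $\mathbb R^4$ consists of symmetric endomorphisms of $\mathbb R^4$ with $P_iP_j+P_jP_i=2\delta_{ij}I$; it is irreducible if $\mathbb R^4$ is not a direct sum of two non-zero subspaces that are invariant under all $P_i$. Two such systems $P$ and $Q$ are algebraically equivalent if there is $A\in O(4)$ with $Q_i=AP_iA^t$ for all $i$. Two maps $\psi,\tilde\psi:S^3\to S^2$ of unit spheres are bi-equivalent if $\psi=G^{-1}\circ\tilde\psi\circ P$ for an isometry $P$ of $S^3$ and an isometry $G$ of $S^2$. The standard Hopf fibration $S^3\to S^2$ is the restriction to $S^3$ of $$\varphi_0(x)=\bigl(x_1^2+x_2^2-x_3^2-x_4^2,\ 2x_1x_3+2x_2x_4,\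 -2x_1x_4+2x_2x_3\bigr).$$ **Corollary 3.6.** (1) Let $\varphi:\mathbb R^4\to\mathbb R^3$ be a quadratic harmonic morphism. Then there are $r>0$ and an irreducible Clifford system $(P_0,P_1,P_2)$ on $\mathbb R^4$ such that $$\varphi(rx)=\bigl(\langle P_0x,x\rangle,\langle P_1x,x\rangle,\langle P_2x,x\rangle\bigr)\qquad\text{for all }x\in\mathbb R^4,$$ and, for the same $r$, the map $x\mapsto\varphi(rx)$ restricts to a harmonic morphism $S^3\to S^2$ of the round unit spheres that is bi-equivalent to the standard Hopf fibration. (2) All Clifford systems that arise in this way are algebraically equivalent: if $\varphi,\varphi':\mathbb R^4\to\mathbb R^3$ are quadratic harmonic morphisms, $r,r'>0$, and $P,P'$ are Clifford systems with $\varphi(rx)=(\langle P_ix,x\rangle)_{i=0,1,2}$ and $\varphi'(r'x)=(\langle P'_ix,x\rangle)_{i=0,1,2}$ for all $x\in\mathbb R^4$, then $P$ and $P'$ are algebraically equivalent. -/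

import Mathlib

noncomputable section

open InnerProductSpace Metric Module
open scoped ContDiff Manifold

/-- A map `ℝᵐ → ℝⁿ` is quadratic if each of its components is a quadratic form (a homogeneous
polynomial of degree two) in the coordinates. -/
def IsQuadratic {m n : ℕ} (φ : EuclideanSpace ℝ (Fin m) → EuclideanSpace ℝ (Fin n)) : Prop :=
  ∀ i : Fin n, ∃ p : MvPolynomial (Fin m) ℝ,
    p.IsHomogeneous 2 ∧ ∀ x : EuclideanSpace ℝ (Fin m), φ x i = MvPolynomial.eval (fun j => x j) p

/-- A smooth map between Euclidean spaces is a harmonic morphism if it pulls back every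
(locally defined) harmonic function to a harmonic function. -/
def IsHarmonicMorphism {m n : ℕ}
    (φ : EuclideanSpace ℝ (Fin m) → EuclideanSpace ℝ (Fin n)) : Prop :=
  ContDiff ℝ ∞ φ ∧
    ∀ (V : Set (EuclideanSpace ℝ (Fin n))) (f : EuclideanSpace ℝ (Fin n) → ℝ),
      IsOpen V → HarmonicOnNhd f V → HarmonicOnNhd (f ∘ φ) (φ ⁻¹' V)

/-- Quadratic harmonic morphisms; they are non-constant by convention (the zero form does not
count as a form of degree two). -/
structure IsQuadraticHarmonicMorphism {m n : ℕ}
    (φ : EuclideanSpace ℝ (Fin m) → EuclideanSpace ℝ (Fin n)) : Prop where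
  isQuadratic : IsQuadratic φ
  isHarmonicMorphism : IsHarmonicMorphism φ
  nonconstant : ∃ x y, φ x ≠ φ y

/-- The unit sphere `Sⁿ` in `ℝⁿ⁺¹`. -/
abbrev UnitSphere (n : ℕ) : Type := sphere (0 : EuclideanSpace ℝ (Fin (n + 1))) 1

/-- The extension `y ↦ f (y / ‖y‖)` of a function on the unit sphere which is constant along
rays (with value `0` at the origin). -/
def radialExtension {n : ℕ} (f : UnitSphere n → ℝ) (y : EuclideanSpace ℝ (Fin (n + 1))) : ℝ :=
  open Classical in
  if hy : y = 0 then 0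
  else f ⟨‖y‖⁻¹ • y, by simp [norm_smul, hy]⟩

/-- `f : Sⁿ → ℝ` is harmonic on the set `V` (meant to be open), for the round metric.
The Laplace--Beltrami operator of the unit sphere is
`(Δ_{Sⁿ} f)(x) = (Δ F)(x)` for `x ∈ Sⁿ`, where `F` is the radial extension of `f` and `Δ` is the
Laplacian of `ℝⁿ⁺¹`; moreover `(Δ F)(t x) = t⁻² (Δ F)(x)` for `t > 0`, and `F` is `C²` near
`x` exactly if `f` is. -/
def SphereHarmonicOn {n : ℕ} (f : UnitSphere n → ℝ) (V : Set (UnitSphere n)) : Prop :=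
  ∀ x ∈ V, HarmonicAt (radialExtension f) (x : EuclideanSpace ℝ (Fin (n + 1)))

/-- A smooth map between unit spheres is a harmonic morphism if it pulls back every
(locally defined) harmonic function to a harmonic function. -/
def IsSphereHarmonicMorphism {m n : ℕ} (ψ : UnitSphere m → UnitSphere n) : Prop :=
  ContMDiff (𝓡 m) (𝓡 n) ∞ ψ ∧
    ∀ (V : Set (UnitSphere n)) (f : UnitSphere n → ℝ),
      IsOpen V → SphereHarmonicOn f V → SphereHarmonicOn (f ∘ ψ) (ψ ⁻¹' V)

/-- Bi-equivalence `ψ = G⁻¹ ∘ ψ' ∘ P` of maps, with isometries `P` and `G`. On unit spheres the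
metric of Mathlib is the chordal one; it has the same isometries as the great circle distance,
i.e. as the round Riemannian metric. -/
def BiEquivalent {X Y : Type*} [MetricSpace X] [MetricSpace Y] (ψ ψ' : X → Y) : Prop :=
  ∃ (P : X ≃ᵢ X) (G : Y ≃ᵢ Y), ψ = G.symm ∘ ψ' ∘ P

/-- A tuple of symmetric endomorphisms of `ℝᵈ` is a Clifford system if
`Pᵢ Pⱼ + Pⱼ Pᵢ = 2 δᵢⱼ I`. -/
structure IsCliffordSystem {k d : ℕ} (P : Fin k → End ℝ (EuclideanSpace ℝ (Fin d))) : Prop where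
  isSymmetric : ∀ i, (P i).IsSymmetric
  anticomm : ∀ i j, P i * P j + P j * P i = if i = j then (2 : ℝ) • 1 else 0

/-- A tuple of endomorphisms is irreducible if the space is not the direct sum of two non-zero
subspaces each of which is invariant under all of them. -/
def IsIrreducibleSystem {k d : ℕ} (P : Fin k → End ℝ (EuclideanSpace ℝ (Fin d))) : Prop :=
  ¬ ∃ U W : Submodule ℝ (EuclideanSpace ℝ (Fin d)), U ≠ ⊥ ∧ W ≠ ⊥ ∧ IsCompl U W ∧
    ∀ i, (∀ x ∈ U, P i x ∈ U) ∧ (∀ x ∈ W, P i x ∈ W)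

/-- Algebraic equivalence `Qᵢ = A Pᵢ Aᵗ` with one orthogonal map `A` (so `Aᵗ = A⁻¹`). -/
def AlgebraicallyEquivalent {k d : ℕ} (P Q : Fin k → End ℝ (EuclideanSpace ℝ (Fin d))) : Prop :=
  ∃ A : EuclideanSpace ℝ (Fin d) ≃ₗᵢ[ℝ] EuclideanSpace ℝ (Fin d),
    ∀ i x, Q i x = A (P i (A.symm x))

/-- The map `X ↦ (⟨P₀ X, X⟩, …, ⟨Pₙ X, X⟩)`. -/
def cliffordMap {k d : ℕ} (P : Fin k → End ℝ (EuclideanSpace ℝ (Fin d)))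
    (x : EuclideanSpace ℝ (Fin d)) : EuclideanSpace ℝ (Fin k) :=
  WithLp.toLp 2 fun i => inner ℝ (P i x) x

/-- The standard Hopf construction map `ℝ⁴ → ℝ³`. -/
def hopfMap (x : EuclideanSpace ℝ (Fin 4)) : EuclideanSpace ℝ (Fin 3) :=
  !₂[x 0 ^ 2 + x 1 ^ 2 - x 2 ^ 2 - x 3 ^ 2,
    2 * x 0 * x 2 + 2 * x 1 * x 3,
    -2 * x 0 * x 3 + 2 * x 1 * x 2]

theorem norm_hopfMap (x : EuclideanSpace ℝ (Fin 4)) : ‖hopfMap x‖ = ‖x‖ ^ 2 := by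
  have h : ‖hopfMap x‖ ^ 2 = (‖x‖ ^ 2) ^ 2 := by
    simp [EuclideanSpace.norm_sq_eq, hopfMap, Fin.sum_univ_succ]
    ring
  exact (pow_left_inj₀ (norm_nonneg _) (by positivity) two_ne_zero).1 h

/-- The standard Hopf fibration `S³ → S²`, the restriction of the Hopf construction map. -/
def hopfFibration (x : UnitSphere 3) : UnitSphere 2 :=
  ⟨hopfMap x, by simp [norm_hopfMap]⟩

end

/-! Write `φ` as `⟨A i x, x⟩` with symmetric `A i`. Since the coordinates `y i` are harmonic, so are
the components of `φ`, and `Δ (φ i * φ j) = 8 ⟨A i x, A j x⟩`. Testing with the harmonic polynomials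
`y i * y j` and `y i ^ 2 - y j ^ 2` then makes the `A i` anticommute with equal squares.

Non-constancy gives `A 0` a non-zero eigenvalue, and `A 1` exchanges its sign, so some eigenvalue is
positive. After scaling, a unit vector `v` satisfies `P 0 v = v`; the frame `v, P₂P₁v, P₁v, -P₂v` is
orthonormal, hence a basis of `ℝ⁴`, and in it the `P i` are the Hopf matrices
(`algebraicallyEquivalent_hopfSystem`). The Clifford relations are thus inherited from `hopfSystem`;
there is no separate proof that `A 0 ^ 2` is scalar.

The same frame gives irreducibility (an invariant subspace containing `v` is everything) and
uniqueness (every Clifford system is equivalent to `hopfSystem`). Harmonicity passes to spheres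
through radial extensions. -/

open InnerProductSpace Metric Module Laplacian
open scoped ContDiff Manifold Topology

/-! ### Product and scaling rules for the Laplacian. -/

section Laplacian

variable {E : Type*} [NormedAddCommGroup E] [InnerProductSpace ℝ E] [FiniteDimensional ℝ E]

theorem laplacian_eq_sum_fderiv_fderiv {ι : Type*} [Fintype ι] (b : OrthonormalBasis ι ℝ E)
    (f : E → ℝ) (x : E) : Δ f x = ∑ i, fderiv ℝ (fderiv ℝ f) x (b i) (b i) := by
  rw [laplacian_eq_iteratedFDeriv_orthonormalBasis f b]
  simp [iteratedFDeriv_two_apply]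

theorem ContDiff.laplacian_mul {ι : Type*} [Fintype ι] (b : OrthonormalBasis ι ℝ E)
    {f g : E → ℝ} (hf : ContDiff ℝ 2 f) (hg : ContDiff ℝ 2 g) (x : E) :
    Δ (fun y => f y * g y) x = f x * Δ g x + g x * Δ f x +
      2 * ∑ i, fderiv ℝ f x (b i) * fderiv ℝ g x (b i) := by
  have df : Differentiable ℝ f := hf.differentiable (by norm_num)
  have dg : Differentiable ℝ g := hg.differentiable (by norm_num)
  have df' : Differentiable ℝ (fderiv ℝ f) :=
    (hf.fderiv_right (m := 1) (by norm_num)).differentiable (by norm_num)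
  have dg' : Differentiable ℝ (fderiv ℝ g) :=
    (hg.fderiv_right (m := 1) (by norm_num)).differentiable (by norm_num)
  have h1 : fderiv ℝ (fun y => f y * g y) = fun y => f y • fderiv ℝ g y + g y • fderiv ℝ f y := by
    ext1 y
    exact fderiv_fun_mul (df y) (dg y)
  have h2 := (((df x).hasFDerivAt.smul (dg' x).hasFDerivAt).add
    ((dg x).hasFDerivAt.smul (df' x).hasFDerivAt)).fderiv
  simp only [laplacian_eq_sum_fderiv_fderiv b, Finset.mul_sum, ← Finset.sum_add_distrib]
  refine Finset.sum_congr rfl fun i _ => ?_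
  rw [h1]
  have h3 := congrArg (fun L => L (b i) (b i)) h2
  refine (h3 :).trans ?_
  simp
  ring

theorem laplacian_clm (L : E →L[ℝ] ℝ) (x : E) : Δ (fun y => L y) x = 0 := by
  have h : fderiv ℝ (fun y => L y) = fun _ => L := by ext1 y; exact L.fderiv
  rw [laplacian_eq_sum_fderiv_fderiv (stdOrthonormalBasis ℝ E), h]
  simp

theorem laplacian_comp_smul (c : ℝ) (f : E → ℝ) (x : E) :
    Δ (fun y => f (c • y)) x = c ^ 2 * Δ f (c • x) := by
  have h : fderiv ℝ (fun y => f (c • y)) = c • fun y => fderiv ℝ f (c • y) := by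
    ext1 y
    exact fderiv_comp_smul ..
  have h2 : fderiv ℝ (c • fun y => fderiv ℝ f (c • y)) x =
      c • c • fderiv ℝ (fderiv ℝ f) (c • x) := by
    have h1 : fderiv ℝ (fun y => fderiv ℝ f (c • y)) x = c • fderiv ℝ (fderiv ℝ f) (c • x) :=
      fderiv_comp_smul ..
    rw [← h1]
    exact congrFun (fderiv_const_smul_field (f := fun y => fderiv ℝ f (c • y)) c) x
  simp only [laplacian_eq_sum_fderiv_fderiv (stdOrthonormalBasis ℝ E), Finset.mul_sum, h, h2]
  refine Finset.sum_congr rfl fun i _ => ?_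
  simp only [smul_apply, smul_eq_mul]
  ring

theorem InnerProductSpace.HarmonicAt.comp_smul {c : ℝ} {f : E → ℝ} {x : E}
    (h : HarmonicAt f (c • x)) : HarmonicAt (fun y => f (c • y)) x := by
  refine ⟨ContDiffAt.comp x (g := f) (f := fun y => c • y) h.1 (by fun_prop), ?_⟩
  have ht : Filter.Tendsto (fun y : E => c • y) (𝓝 x) (𝓝 (c • x)) :=
    (continuous_const_smul c).tendsto x
  filter_upwards [ht.eventually h.2] with y hy
  rw [laplacian_comp_smul, hy]
  simp

theorem laplacian_eq_zero_of_harmonicOnNhd {f : E → ℝ} {s : Set E} (h : HarmonicOnNhd f s)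
    {x : E} (hx : x ∈ s) : Δ f x = 0 := (h x hx).2.self_of_nhds

end Laplacian

/-! ### Harmonic test polynomials of degree one and two. -/

section Coordinates

variable {n : ℕ}

theorem fderiv_coord (i : Fin n) (x v : EuclideanSpace ℝ (Fin n)) :
    fderiv ℝ (fun y : EuclideanSpace ℝ (Fin n) => y i) x v = v i := by
  have h : (fun y : EuclideanSpace ℝ (Fin n) => y i) =
      (EuclideanSpace.proj i : EuclideanSpace ℝ (Fin n) →L[ℝ] ℝ) := rfl
  rw [h, ContinuousLinearMap.fderiv]
  rfl

theorem contDiff_coord (i : Fin n) {k : ℕ∞ω} :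
    ContDiff ℝ k (fun y : EuclideanSpace ℝ (Fin n) => y i) :=
  (EuclideanSpace.proj i : EuclideanSpace ℝ (Fin n) →L[ℝ] ℝ).contDiff

theorem laplacian_coord (i : Fin n) (x : EuclideanSpace ℝ (Fin n)) :
    Δ (fun y : EuclideanSpace ℝ (Fin n) => y i) x = 0 :=
  laplacian_clm (EuclideanSpace.proj i : EuclideanSpace ℝ (Fin n) →L[ℝ] ℝ) x

theorem laplacian_coord_mul_coord (i j : Fin n) (x : EuclideanSpace ℝ (Fin n)) :
    Δ (fun y : EuclideanSpace ℝ (Fin n) => y i * y j) x = if i = j then 2 else 0 := by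
  rw [ContDiff.laplacian_mul (EuclideanSpace.basisFun (Fin n) ℝ) (contDiff_coord i)
    (contDiff_coord j), laplacian_coord, laplacian_coord]
  simp [fderiv_coord]

theorem harmonicOnNhd_coord (i : Fin n) :
    HarmonicOnNhd (fun y : EuclideanSpace ℝ (Fin n) => y i) Set.univ :=
  fun _ _ => ⟨(contDiff_coord i).contDiffAt, .of_forall fun x => laplacian_coord i x⟩

theorem harmonicOnNhd_coord_mul_coord {i j : Fin n} (h : i ≠ j) :
    HarmonicOnNhd (fun y : EuclideanSpace ℝ (Fin n) => y i * y j) Set.univ :=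
  fun _ _ => ⟨((contDiff_coord i).mul (contDiff_coord j)).contDiffAt,
    .of_forall fun x => by simp [laplacian_coord_mul_coord, h]⟩

theorem harmonicOnNhd_coord_sq_sub (i j : Fin n) :
    HarmonicOnNhd ((fun y : EuclideanSpace ℝ (Fin n) => y i * y i) - fun y => y j * y j)
      Set.univ := by
  have hc (k : Fin n) : ContDiff ℝ 2 (fun y : EuclideanSpace ℝ (Fin n) => y k * y k) :=
    (contDiff_coord k).mul (contDiff_coord k)
  refine fun _ _ => ⟨((hc i).sub (hc j)).contDiffAt, .of_forall fun x => ?_⟩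
  rw [(hc i).contDiffAt.laplacian_sub (hc j).contDiffAt]
  simp [laplacian_coord_mul_coord]

end Coordinates

/-! ### Algebraic relations forced by the test polynomials. -/

section Gradient

variable {m n : ℕ} {φ : EuclideanSpace ℝ (Fin m) → EuclideanSpace ℝ (Fin n)}

theorem IsHarmonicMorphism.contDiff_apply (hφ : IsHarmonicMorphism φ) (i : Fin n) :
    ContDiff ℝ 2 (fun x => φ x i) :=
  (contDiff_coord i).comp (contDiff_infty.1 hφ.1 2)

theorem IsHarmonicMorphism.laplacian_comp (hφ : IsHarmonicMorphism φ)
    {f : EuclideanSpace ℝ (Fin n) → ℝ} (hf : HarmonicOnNhd f Set.univ)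
    (x : EuclideanSpace ℝ (Fin m)) : Δ (f ∘ φ) x = 0 :=
  laplacian_eq_zero_of_harmonicOnNhd (hφ.2 _ f isOpen_univ hf) (Set.mem_univ _)

theorem IsHarmonicMorphism.laplacian_mul_apply (hφ : IsHarmonicMorphism φ) (i j : Fin n)
    (x : EuclideanSpace ℝ (Fin m)) :
    Δ (fun x => φ x i * φ x j) x = 2 * ∑ k, fderiv ℝ (fun x => φ x i) x
      (EuclideanSpace.basisFun (Fin m) ℝ k) * fderiv ℝ (fun x => φ x j) x
      (EuclideanSpace.basisFun (Fin m) ℝ k) := by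
  have h (i : Fin n) : Δ (fun x => φ x i) x = 0 := hφ.laplacian_comp (harmonicOnNhd_coord i) x
  rw [ContDiff.laplacian_mul (EuclideanSpace.basisFun (Fin m) ℝ) (hφ.contDiff_apply i)
    (hφ.contDiff_apply j), h i, h j]
  ring

variable {A : Fin n → End ℝ (EuclideanSpace ℝ (Fin m))}

theorem fderiv_inner_map_self {E : Type*} [NormedAddCommGroup E] [InnerProductSpace ℝ E]
    [FiniteDimensional ℝ E] {T : End ℝ E} (hT : T.IsSymmetric) (x v : E) :
    fderiv ℝ (fun y => inner ℝ (T y) y) x v = 2 * inner ℝ (T x) v := by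
  have h := ((LinearMap.toContinuousLinearMap T).hasFDerivAt (x := x)).inner ℝ (hasFDerivAt_id x)
  have h3 := congrArg (fun L => L v) h.fderiv
  refine (h3 :).trans ?_
  have := hT v x
  simp [real_inner_comm] at this ⊢
  linarith

/-- The gradient of `⟨A i x, x⟩` is `2 A i x`; with the factor 2 of the product rule this yields 8.
-/
theorem IsHarmonicMorphism.laplacian_mul_apply_eq_inner (hφ : IsHarmonicMorphism φ)
    (hA : ∀ i, (A i).IsSymmetric) (hφA : ∀ x i, φ x i = inner ℝ (A i x) x) (i j : Fin n)
    (x : EuclideanSpace ℝ (Fin m)) :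
    Δ (fun x => φ x i * φ x j) x = 8 * inner ℝ (A i x) (A j x) := by
  rw [hφ.laplacian_mul_apply]
  simp only [hφA, fderiv_inner_map_self (hA _)]
  rw [← (EuclideanSpace.basisFun (Fin m) ℝ).sum_inner_mul_inner (A i x), Finset.mul_sum,
    Finset.mul_sum]
  refine Finset.sum_congr rfl fun k _ => ?_
  rw [real_inner_comm (A j x)]
  ring

/-- A symmetric operator with vanishing quadratic form is zero; here the form is `2 ⟨A i x, A j x⟩`.
-/
theorem IsHarmonicMorphism.anticomm (hφ : IsHarmonicMorphism φ)
    (hA : ∀ i, (A i).IsSymmetric) (hφA : ∀ x i, φ x i = inner ℝ (A i x) x) {i j : Fin n}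
    (hij : i ≠ j) (x : EuclideanSpace ℝ (Fin m)) : A i (A j x) + A j (A i x) = 0 := by
  have hS : (A i * A j + A j * A i).IsSymmetric := fun x y => by
    simp [inner_add_left, inner_add_right, hA i _ y, hA j _ y, hA i _ (A j y), hA j _ (A i y)]
    rw [← hA i, ← hA j]; simp [hA i _ (A j y), hA j _ (A i y)]; ring
  have h0 : A i * A j + A j * A i = 0 := hS.inner_map_self_eq_zero.1 fun x => by
    have h1 : Δ (fun x => φ x i * φ x j) x = 0 :=
      hφ.laplacian_comp (harmonicOnNhd_coord_mul_coord hij) x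
    rw [hφ.laplacian_mul_apply_eq_inner hA hφA] at h1
    have h2 := hA i (A j x) x
    have h3 := hA j (A i x) x
    rw [real_inner_comm] at h2
    simp [inner_add_left, h3] at h1 ⊢
    rw [real_inner_comm] at h2
    simp [h2, real_inner_comm, h1]
  exact congrArg (fun L => L x) h0

theorem IsHarmonicMorphism.sq_eq_sq (hφ : IsHarmonicMorphism φ)
    (hA : ∀ i, (A i).IsSymmetric) (hφA : ∀ x i, φ x i = inner ℝ (A i x) x) (i j : Fin n)
    (x : EuclideanSpace ℝ (Fin m)) : A i (A i x) = A j (A j x) := by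
  have hsq (i : Fin n) : (A i * A i).IsSymmetric := fun x y => by simp [hA i _ _]
  have h0 : A i * A i - A j * A j = 0 := ((hsq i).sub (hsq j)).inner_map_self_eq_zero.1 fun x => by
    have h1 : Δ ((fun x => φ x i * φ x i) - fun x => φ x j * φ x j) x = 0 :=
      hφ.laplacian_comp (harmonicOnNhd_coord_sq_sub i j) x
    have hc (k : Fin n) : ContDiff ℝ 2 (fun x => φ x k * φ x k) :=
      (hφ.contDiff_apply k).mul (hφ.contDiff_apply k)
    rw [(hc i).contDiffAt.laplacian_sub (hc j).contDiffAt,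
      hφ.laplacian_mul_apply_eq_inner hA hφA, hφ.laplacian_mul_apply_eq_inner hA hφA] at h1
    simp only [LinearMap.sub_apply, Module.End.mul_apply, inner_sub_left, hA i _ x, hA j _ x]
    linarith
  exact sub_eq_zero.1 (congrArg (fun L => L x) h0)

end Gradient

/-! ### From homogeneous polynomials to symmetric operators. -/

section QuadraticForms

theorem MvPolynomial.IsHomogeneous.exists_eval_eq_inner {m : ℕ} {p : MvPolynomial (Fin m) ℝ}
    (hp : p.IsHomogeneous 1) : ∃ a : EuclideanSpace ℝ (Fin m),
      ∀ x : EuclideanSpace ℝ (Fin m), eval (fun j => x j) p = inner ℝ a x := by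
  rw [← mem_homogeneousSubmodule, homogeneousSubmodule_one_eq_span_X] at hp
  induction hp using Submodule.span_induction with
  | mem q hq =>
    obtain ⟨i, rfl⟩ := hq
    exact ⟨EuclideanSpace.single i 1, fun x => by simp [EuclideanSpace.inner_single_left]⟩
  | zero => exact ⟨0, by simp⟩
  | add q r _ _ hq hr =>
    obtain ⟨a, ha⟩ := hq
    obtain ⟨b, hb⟩ := hr
    exact ⟨a + b, fun x => by simp [ha, hb, inner_add_left]⟩
  | smul c q _ hq =>
    obtain ⟨a, ha⟩ := hq
    exact ⟨c • a, fun x => by simp [ha, real_inner_smul_left]⟩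

/-- Quadratic forms are spanned by products of two linear forms, and such a product is the form of a
symmetrized rank-one operator. -/
theorem MvPolynomial.IsHomogeneous.exists_isSymmetric_eval_eq_inner {m : ℕ}
    {p : MvPolynomial (Fin m) ℝ} (hp : p.IsHomogeneous 2) :
    ∃ A : End ℝ (EuclideanSpace ℝ (Fin m)), A.IsSymmetric ∧
      ∀ x : EuclideanSpace ℝ (Fin m), eval (fun j => x j) p = inner ℝ (A x) x := by
  rw [← mem_homogeneousSubmodule, ← homogeneousSubmodule_one_pow, pow_two] at hp
  induction hp using Submodule.mul_induction_on' with
  | mem_mul_mem q hq r hr =>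
    obtain ⟨a, ha⟩ := exists_eval_eq_inner hq
    obtain ⟨b, hb⟩ := exists_eval_eq_inner hr
    refine ⟨(1 / 2 : ℝ) • ((innerₗ _ a).smulRight b + (innerₗ _ b).smulRight a), ?_, ?_⟩
    · intro x y
      simp [inner_add_left, real_inner_smul_left, real_inner_comm _ x]
      ring
    · intro x
      simp [inner_add_left, real_inner_smul_left, ha, hb]
      ring
  | add q _ r _ hq hr =>
    obtain ⟨A, hA, hqA⟩ := hq
    obtain ⟨B, hB, hrB⟩ := hr
    exact ⟨A + B, hA.add hB, fun x => by simp [hqA, hrB, inner_add_left]⟩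

theorem IsQuadratic.exists_isSymmetric {m n : ℕ}
    {φ : EuclideanSpace ℝ (Fin m) → EuclideanSpace ℝ (Fin n)} (hφ : IsQuadratic φ) :
    ∃ A : Fin n → End ℝ (EuclideanSpace ℝ (Fin m)), (∀ i, (A i).IsSymmetric) ∧
      ∀ x i, φ x i = inner ℝ (A i x) x := by
  have h (i : Fin n) : ∃ A : End ℝ (EuclideanSpace ℝ (Fin m)), A.IsSymmetric ∧
      ∀ x, φ x i = inner ℝ (A x) x := by
    obtain ⟨p, hp, hφp⟩ := hφ i
    obtain ⟨A, hA, hpA⟩ := hp.exists_isSymmetric_eval_eq_inner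
    exact ⟨A, hA, fun x => (hφp x).trans (hpA x)⟩
  choose A hA hφA using h
  exact ⟨A, hA, fun x i => hφA i x⟩

end QuadraticForms

/-- The matrices of the quadratic forms which are the components of the Hopf construction map. -/
def hopfMatrix : Fin 3 → Matrix (Fin 4) (Fin 4) ℝ :=
  ![!![1, 0, 0, 0; 0, 1, 0, 0; 0, 0, -1, 0; 0, 0, 0, -1],
    !![0, 0, 1, 0; 0, 0, 0, 1; 1, 0, 0, 0; 0, 1, 0, 0],
    !![0, 0, 0, -1; 0, 0, 1, 0; 0, 1, 0, 0; -1, 0, 0, 0]]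

/-- The Clifford system of the Hopf construction map. -/
noncomputable def hopfSystem (i : Fin 3) : End ℝ (EuclideanSpace ℝ (Fin 4)) :=
  Matrix.toEuclideanLin (hopfMatrix i)

theorem hopfSystem_zero_apply (x : EuclideanSpace ℝ (Fin 4)) :
    hopfSystem 0 x = !₂[x 0, x 1, -x 2, -x 3] := by
  ext i
  fin_cases i <;>
    simp [hopfSystem, hopfMatrix, Matrix.toLpLin_apply, dotProduct, Fin.sum_univ_four]

theorem hopfSystem_one_apply (x : EuclideanSpace ℝ (Fin 4)) :
    hopfSystem 1 x = !₂[x 2, x 3, x 0, x 1] := by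
  ext i
  fin_cases i <;>
    simp [hopfSystem, hopfMatrix, Matrix.toLpLin_apply, dotProduct, Fin.sum_univ_four]

theorem hopfSystem_two_apply (x : EuclideanSpace ℝ (Fin 4)) :
    hopfSystem 2 x = !₂[-x 3, x 2, x 1, -x 0] := by
  ext i
  fin_cases i <;>
    simp [hopfSystem, hopfMatrix, Matrix.toLpLin_apply, dotProduct, Fin.sum_univ_four]

theorem cliffordMap_hopfSystem (x : EuclideanSpace ℝ (Fin 4)) :
    cliffordMap hopfSystem x = hopfMap x := by
  ext i
  fin_cases i <;>
    simp [cliffordMap, hopfMap, hopfSystem_zero_apply, hopfSystem_one_apply, hopfSystem_two_apply,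
      PiLp.inner_apply, Fin.sum_univ_four] <;> ring

/-- A triple of symmetric, pairwise anticommuting endomorphisms with equal squares. -/
structure IsAnticommutingTriple {E : Type*} [NormedAddCommGroup E] [InnerProductSpace ℝ E]
    (P : Fin 3 → End ℝ E) : Prop where
  isSymmetric : ∀ i, (P i).IsSymmetric
  anticomm : ∀ i j, i ≠ j → ∀ x, P i (P j x) = -P j (P i x)
  sq_eq : ∀ i x, P i (P i x) = P 0 (P 0 x)

/-! ### Adapted frames and the normal form in dimension four. -/

namespace IsAnticommutingTriple

section

variable {E : Type*} [NormedAddCommGroup E] [InnerProductSpace ℝ E] {P : Fin 3 → End ℝ E}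

theorem smul (hP : IsAnticommutingTriple P) (c : ℝ) :
    IsAnticommutingTriple fun i => c • P i where
  isSymmetric i := (hP.isSymmetric i).smul (by simp)
  anticomm i j hij x := by simp [hP.anticomm i j hij x]
  sq_eq i x := by simp [hP.sq_eq i x]

/-- The adapted frame `v, P₂P₁v, P₁v, -P₂v`. -/
def frame (P : Fin 3 → End ℝ E) (v : E) : Fin 4 → E := ![v, P 2 (P 1 v), P 1 v, -P 2 v]

/-- The first two vectors lie in the `+1` and the last two in the `-1` eigenspace of the symmetric
`P 0`. Within each pair, orthogonality holds because `P₁P₂` is skew. -/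
theorem orthonormal_frame (hP : IsAnticommutingTriple P) {v : E} (hv : P 0 v = v)
    (hn : ‖v‖ = 1) : Orthonormal ℝ (frame P v) := by
  have hsq (i : Fin 3) : P i (P i v) = v := by rw [hP.sq_eq, hv, hv]
  have a10 : P 0 (P 1 v) = -P 1 v := by rw [hP.anticomm 0 1 (by decide), hv]
  have a20 : P 0 (P 2 v) = -P 2 v := by rw [hP.anticomm 0 2 (by decide), hv]
  have a210 : P 0 (P 2 (P 1 v)) = P 2 (P 1 v) := by
    rw [hP.anticomm 0 2 (by decide), a10, map_neg, neg_neg]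
  have orth {x y : E} (hx : P 0 x = x) (hy : P 0 y = -y) : inner ℝ x y = 0 := by
    have h := hP.isSymmetric 0 x y
    rw [hx, hy, inner_neg_right] at h
    linarith
  have h12 : inner ℝ (P 1 v) (P 2 v) = 0 := by
    have h1 := hP.isSymmetric 1 v (P 2 v)
    have h2 := hP.isSymmetric 2 (P 1 v) v
    rw [hP.anticomm 1 2 (by decide), inner_neg_right, real_inner_comm, real_inner_comm _ v] at h1
    rw [real_inner_comm] at h1
    linarith
  have hv1 : inner ℝ v v = 1 := by rw [real_inner_self_eq_norm_sq, hn, one_pow]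
  have h11 : inner ℝ (P 1 v) (P 1 v) = 1 := by rw [hP.isSymmetric 1, hsq, hv1]
  have h22 : inner ℝ (P 2 v) (P 2 v) = 1 := by rw [hP.isSymmetric 2, hsq, hv1]
  have h2121 : inner ℝ (P 2 (P 1 v)) (P 2 (P 1 v)) = 1 := by
    rw [hP.isSymmetric 2, hP.sq_eq 2, a10, map_neg, a10, neg_neg, h11]
  have h021 : inner ℝ v (P 2 (P 1 v)) = 0 := by rw [← hP.isSymmetric 2, real_inner_comm, h12]
  have o1 := orth hv a10
  have o2 := orth hv a20
  have o3 := orth a210 a10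
  have o4 := orth a210 a20
  rw [orthonormal_iff_ite]
  intro i j
  fin_cases i <;> fin_cases j <;> simp only [frame] <;>
    simp [hv1, h11, h22, h2121, h021, o1, o2, o3, o4, h12, -inner_self_eq_norm_sq_to_K] <;>
    rw [real_inner_comm] <;> assumption

/-- The eigenvalues of `P₀` come in pairs `±c`. -/
theorem exists_pos_eigenvector (hP : IsAnticommutingTriple P) {u : E} {c : ℝ} (hc : c ≠ 0)
    (hu : u ≠ 0) (hcu : P 0 u = c • u) :
    ∃ (c' : ℝ) (v : E), 0 < c' ∧ v ≠ 0 ∧ P 0 v = c' • v := by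
  rcases lt_or_gt_of_ne hc with h | h
  · refine ⟨-c, P 1 u, neg_pos.2 h, fun h0 => ?_, ?_⟩
    · have h1 := hP.sq_eq 1 u
      rw [h0, map_zero, hcu, map_smul, hcu, smul_smul, eq_comm] at h1
      simp [hc, hu] at h1
    · rw [hP.anticomm 0 1 (by decide), hcu, map_smul, neg_smul]
  · exact ⟨c, u, h, hu, hcu⟩

end

variable {P : Fin 3 → End ℝ (EuclideanSpace ℝ (Fin 4))}

theorem span_frame_eq_top (hP : IsAnticommutingTriple P) {v : EuclideanSpace ℝ (Fin 4)}
    (hv : P 0 v = v) (hn : ‖v‖ = 1) : Submodule.span ℝ (Set.range (frame P v)) = ⊤ :=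
  (hP.orthonormal_frame hv hn).linearIndependent.span_eq_top_of_card_eq_finrank (by simp)

theorem algebraicallyEquivalent_hopfSystem (hP : IsAnticommutingTriple P)
    {v : EuclideanSpace ℝ (Fin 4)} (hv : P 0 v = v) (hn : ‖v‖ = 1) :
    AlgebraicallyEquivalent hopfSystem P := by
  have hsq (i : Fin 3) : P i (P i v) = v := by rw [hP.sq_eq, hv, hv]
  have a10 : P 0 (P 1 v) = -P 1 v := by rw [hP.anticomm 0 1 (by decide), hv]
  have a20 : P 0 (P 2 v) = -P 2 v := by rw [hP.anticomm 0 2 (by decide), hv]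
  have a210 : P 0 (P 2 (P 1 v)) = P 2 (P 1 v) := by
    rw [hP.anticomm 0 2 (by decide), a10, map_neg, neg_neg]
  have a12 : P 1 (P 2 v) = -P 2 (P 1 v) := hP.anticomm 1 2 (by decide) v
  have a121 : P 1 (P 2 (P 1 v)) = -P 2 v := by
    rw [hP.anticomm 1 2 (by decide), hsq]
  have a221 : P 2 (P 2 (P 1 v)) = P 1 v := by
    rw [hP.sq_eq, a10, map_neg, a10, neg_neg]
  let b := OrthonormalBasis.mk (hP.orthonormal_frame hv hn) (hP.span_frame_eq_top hv hn).ge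
  have hb (x : EuclideanSpace ℝ (Fin 4)) :
      b.repr.symm x = x 0 • v + x 1 • P 2 (P 1 v) + x 2 • P 1 v + x 3 • -P 2 v := by
    rw [← OrthonormalBasis.sum_repr_symm]
    simp [b, Fin.sum_univ_four, frame]
  have key (i : Fin 3) (x : EuclideanSpace ℝ (Fin 4)) :
      P i (b.repr.symm x) = b.repr.symm (hopfSystem i x) := by
    rw [hb, hb]
    fin_cases i
    · simp [hopfSystem_zero_apply, hv, a10, a20, a210]
    · simp [hopfSystem_one_apply, hsq, a12, a121]
      module
    · simp [hopfSystem_two_apply, hsq, a221]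
      module
  refine ⟨b.repr.symm, fun i x => ?_⟩
  rw [← key, LinearIsometryEquiv.apply_symm_apply]

theorem exists_smul_algebraicallyEquivalent_hopfSystem (hP : IsAnticommutingTriple P)
    (h0 : P 0 ≠ 0) : ∃ c : ℝ, 0 < c ∧ AlgebraicallyEquivalent hopfSystem fun i => c • P i := by
  have hS := hP.isSymmetric 0
  have hn : finrank ℝ (EuclideanSpace ℝ (Fin 4)) = 4 := by simp
  obtain ⟨k, hk⟩ : ∃ k, hS.eigenvalues hn k ≠ 0 := by
    by_contra! h
    refine h0 ((hS.eigenvectorBasis hn).toBasis.ext fun k => ?_)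
    simp [h k]
  obtain ⟨c, v, hc, hv, hcv⟩ := hP.exists_pos_eigenvector hk
    ((hS.eigenvectorBasis hn).orthonormal.ne_zero k) (hS.apply_eigenvectorBasis hn k)
  -- Dividing by the eigenvalue `c` turns the normalized eigenvector into a fixed vector of the new
  -- `P 0`.
  refine ⟨c⁻¹, inv_pos.2 hc, (hP.smul c⁻¹).algebraicallyEquivalent_hopfSystem
    (v := ‖v‖⁻¹ • v) ?_ (by simp [norm_smul, hv])⟩
  simp [hcv, smul_smul, hc.ne']

end IsAnticommutingTriple

/-! ### Transport along orthogonal conjugation. -/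

namespace AlgebraicallyEquivalent

variable {k d : ℕ} {P Q R : Fin k → End ℝ (EuclideanSpace ℝ (Fin d))}

theorem symm (h : AlgebraicallyEquivalent P Q) : AlgebraicallyEquivalent Q P := by
  obtain ⟨A, hA⟩ := h
  exact ⟨A.symm, fun i x => by simp [hA]⟩

theorem trans (h : AlgebraicallyEquivalent P Q) (h' : AlgebraicallyEquivalent Q R) :
    AlgebraicallyEquivalent P R := by
  obtain ⟨A, hA⟩ := h
  obtain ⟨B, hB⟩ := h'
  exact ⟨A.trans B, fun i x => by simp [hA, hB]⟩

theorem isCliffordSystem (h : AlgebraicallyEquivalent P Q) (hP : IsCliffordSystem P) :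
    IsCliffordSystem Q := by
  obtain ⟨A, hA⟩ := h
  refine ⟨fun i x y => ?_, fun i j => ?_⟩
  · have h := hP.isSymmetric i (A.symm x) (A.symm y)
    rwa [← A.inner_map_map, ← A.inner_map_map (A.symm x), A.apply_symm_apply, A.apply_symm_apply, ← hA,
      ← hA] at h
  · ext1 x
    have h := congrArg (fun L => A (L (A.symm x))) (hP.anticomm i j)
    simp only [LinearMap.add_apply, Module.End.mul_apply, map_add] at h
    simp only [LinearMap.add_apply, Module.End.mul_apply, hA, LinearIsometryEquiv.symm_apply_apply,
      h]
    split_ifs <;> simp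

theorem exists_cliffordMap_eq (h : AlgebraicallyEquivalent P Q) :
    ∃ A : EuclideanSpace ℝ (Fin d) ≃ₗᵢ[ℝ] EuclideanSpace ℝ (Fin d),
      ∀ x, cliffordMap Q x = cliffordMap P (A x) := by
  obtain ⟨A, hA⟩ := h
  refine ⟨A.symm, fun x => ?_⟩
  ext i
  simp only [cliffordMap, hA]
  rw [← LinearIsometryEquiv.inner_map_map A.symm, LinearIsometryEquiv.symm_apply_apply]

end AlgebraicallyEquivalent

/-! ### Irreducibility and uniqueness of Clifford systems. -/

namespace IsCliffordSystem

variable {P : Fin 3 → End ℝ (EuclideanSpace ℝ (Fin 4))}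

theorem apply_apply (hP : IsCliffordSystem P) (i : Fin 3) (x : EuclideanSpace ℝ (Fin 4)) :
    P i (P i x) = x := by
  have h := congrArg (fun L => L x) (hP.anticomm i i)
  simp only [if_true, Module.End.mul_apply, ← two_smul ℝ,
    LinearMap.smul_apply, Module.End.one_apply] at h
  exact smul_right_injective _ two_ne_zero h

theorem isAnticommutingTriple (hP : IsCliffordSystem P) : IsAnticommutingTriple P := by
  refine ⟨hP.isSymmetric, fun i j hij x => ?_, fun i x => by simp only [hP.apply_apply]⟩
  have h := congrArg (fun L => L x) (hP.anticomm i j)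
  simp only [hij, if_false] at h
  exact eq_neg_of_add_eq_zero_left h

/-- Each non-zero invariant subspace contains a unit vector which is fixed by `P₀`. -/
theorem exists_fixed_mem (hP : IsCliffordSystem P) {U : Submodule ℝ (EuclideanSpace ℝ (Fin 4))}
    (hU : U ≠ ⊥) (hinv : ∀ i, ∀ x ∈ U, P i x ∈ U) : ∃ v ∈ U, P 0 v = v ∧ ‖v‖ = 1 := by
  suffices h : ∃ v ∈ U, P 0 v = v ∧ v ≠ 0 by
    obtain ⟨v, hvU, hv, hv0⟩ := h
    exact ⟨‖v‖⁻¹ • v, U.smul_mem _ hvU, by simp [hv], by simp [norm_smul, hv0]⟩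
  obtain ⟨u, huU, hu⟩ := U.exists_mem_ne_zero_of_ne_bot hU
  -- As `P 0` is an involution, `u + P 0 u` is fixed. If it vanishes, `u` is in the `-1` eigenspace
  -- and `P 1` carries it to the `+1` eigenspace.
  by_cases h : u + P 0 u = 0
  · have h0 : P 0 u = -u := (neg_eq_of_add_eq_zero_right h).symm
    refine ⟨P 1 u, hinv 1 u huU, ?_, fun h1 => hu ?_⟩
    · rw [hP.isAnticommutingTriple.anticomm 0 1 (by decide), h0, map_neg, neg_neg]
    · rw [← hP.apply_apply 1 u, h1, map_zero]
  · exact ⟨u + P 0 u, U.add_mem huU (hinv 0 u huU), by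
      rw [map_add, hP.apply_apply, add_comm], h⟩

theorem eq_top_of_invariant (hP : IsCliffordSystem P)
    {U : Submodule ℝ (EuclideanSpace ℝ (Fin 4))}
    (hU : U ≠ ⊥) (hinv : ∀ i, ∀ x ∈ U, P i x ∈ U) : U = ⊤ := by
  obtain ⟨v, hvU, hv, hn⟩ := hP.exists_fixed_mem hU hinv
  rw [← top_le_iff, ← hP.isAnticommutingTriple.span_frame_eq_top hv hn, Submodule.span_le]
  rintro _ ⟨i, rfl⟩
  fin_cases i
  · exact hvU
  · exact hinv 2 _ (hinv 1 _ hvU)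
  · exact hinv 1 _ hvU
  · exact U.neg_mem (hinv 2 _ hvU)

theorem isIrreducibleSystem (hP : IsCliffordSystem P) : IsIrreducibleSystem P := by
  rintro ⟨U, W, hU, hW, hUW, hinv⟩
  have h := hP.eq_top_of_invariant hU fun i => (hinv i).1
  rw [h] at hUW
  exact hW (eq_bot_of_isCompl_top hUW.symm)

theorem algebraicallyEquivalent_hopfSystem (hP : IsCliffordSystem P) :
    AlgebraicallyEquivalent hopfSystem P := by
  obtain ⟨v, -, hv, hn⟩ := hP.exists_fixed_mem (U := ⊤) top_ne_bot (by simp)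
  exact hP.isAnticommutingTriple.algebraicallyEquivalent_hopfSystem hv hn

end IsCliffordSystem

theorem isCliffordSystem_hopfSystem : IsCliffordSystem hopfSystem := by
  refine ⟨fun i x y => ?_, fun i j => ?_⟩
  · fin_cases i <;>
      simp [hopfSystem_zero_apply, hopfSystem_one_apply, hopfSystem_two_apply, PiLp.inner_apply,
        Fin.sum_univ_four] <;> ring
  · ext x k
    fin_cases i <;> fin_cases j <;> fin_cases k <;>
      simp [hopfSystem_zero_apply, hopfSystem_one_apply, hopfSystem_two_apply] <;> ring

theorem IsQuadraticHarmonicMorphism.exists_cliffordSystem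
    {φ : EuclideanSpace ℝ (Fin 4) → EuclideanSpace ℝ (Fin 3)}
    (hφ : IsQuadraticHarmonicMorphism φ) :
    ∃ r : ℝ, 0 < r ∧ ∃ P : Fin 3 → End ℝ (EuclideanSpace ℝ (Fin 4)),
      IsCliffordSystem P ∧ ∀ x, φ (r • x) = cliffordMap P x := by
  obtain ⟨A, hA, hφA⟩ := hφ.isQuadratic.exists_isSymmetric
  have hm := hφ.isHarmonicMorphism
  have htriple : IsAnticommutingTriple A := ⟨hA,
    fun i j hij x => eq_neg_of_add_eq_zero_left (hm.anticomm hA hφA hij x),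
    fun i x => hm.sq_eq_sq hA hφA i 0 x⟩
  have h0 : A 0 ≠ 0 := by
    intro h0
    -- `‖A i x‖² = ⟨x, A i (A i x)⟩ = ⟨x, A 0 (A 0 x)⟩ = 0`.
    have hAx (i : Fin 3) (x : EuclideanSpace ℝ (Fin 4)) : A i x = 0 := by
      rw [← inner_self_eq_zero (𝕜 := ℝ), hA i, htriple.sq_eq, h0]
      simp
    obtain ⟨x, y, hxy⟩ := hφ.nonconstant
    exact hxy (by ext i; simp [hφA, hAx])
  obtain ⟨c, hc, hcA⟩ := htriple.exists_smul_algebraicallyEquivalent_hopfSystem h0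
  -- Degree two: scaling the argument by `√c` multiplies the operators by `c`.
  refine ⟨√c, Real.sqrt_pos.2 hc, _, hcA.isCliffordSystem isCliffordSystem_hopfSystem,
    fun x => ?_⟩
  ext i
  simp only [hφA, cliffordMap, map_smul, real_inner_smul_left, real_inner_smul_right,
    LinearMap.smul_apply, ← mul_assoc, Real.mul_self_sqrt hc.le]

/-! ### Restriction to unit spheres via radial extensions. -/

section Sphere

variable {n : ℕ}

theorem radialExtension_smul (f : UnitSphere n → ℝ) {t : ℝ} (ht : 0 < t)
    (y : EuclideanSpace ℝ (Fin (n + 1))) : radialExtension f (t • y) = radialExtension f y := by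
  by_cases hy : y = 0
  · simp [hy]
  · have h : ‖t • y‖⁻¹ • t • y = ‖y‖⁻¹ • y := by
      rw [norm_smul, Real.norm_of_nonneg ht.le, smul_smul, mul_inv, mul_right_comm,
        inv_mul_cancel₀ ht.ne', one_mul]
    simp [radialExtension, hy, ht.ne', h]

theorem radialExtension_of_ne_zero (f : UnitSphere n → ℝ) {y : EuclideanSpace ℝ (Fin (n + 1))}
    (hy : y ≠ 0) : radialExtension f y = f ⟨‖y‖⁻¹ • y, by simp [norm_smul, hy]⟩ := by
  simp [radialExtension, hy]

theorem radialExtension_coe (f : UnitSphere n → ℝ) (x : UnitSphere n) :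
    radialExtension f x = f x := by
  have hx : ‖(x : EuclideanSpace ℝ (Fin (n + 1)))‖ = 1 := norm_eq_of_mem_sphere x
  have h0 : (x : EuclideanSpace ℝ (Fin (n + 1))) ≠ 0 := norm_ne_zero_iff.1 (by simp [hx])
  rw [radialExtension_of_ne_zero f h0]
  simp [hx]

theorem contMDiff_unitSphere_of_contDiff {m : ℕ} {ψ : UnitSphere m → UnitSphere n}
    {Φ : EuclideanSpace ℝ (Fin (m + 1)) → EuclideanSpace ℝ (Fin (n + 1))} (hΦ : ContDiff ℝ ∞ Φ)
    (h : ∀ x, (ψ x : EuclideanSpace ℝ (Fin (n + 1))) = Φ x) : ContMDiff (𝓡 m) (𝓡 n) ∞ ψ := by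
  have (k : ℕ) : Fact (finrank ℝ (EuclideanSpace ℝ (Fin (k + 1))) = k + 1) := ⟨by simp⟩
  have h1 : ContMDiff (𝓡 m) 𝓘(ℝ, EuclideanSpace ℝ (Fin (n + 1))) ∞
      fun x : UnitSphere m => (ψ x : EuclideanSpace ℝ (Fin (n + 1))) := by
    simp only [h]
    exact hΦ.contMDiff.comp contMDiff_coe_sphere
  exact h1.codRestrict_sphere fun x => (ψ x).2

/-- Both sides are constant along rays because `φ` maps rays to rays, and they agree on the sphere.
-/
theorem radialExtension_comp {m : ℕ} {ψ : UnitSphere m → UnitSphere n}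
    {φ : EuclideanSpace ℝ (Fin (m + 1)) → EuclideanSpace ℝ (Fin (n + 1))}
    (hφ : ∀ (t : ℝ) x, φ (t • x) = t ^ 2 • φ x) {r : ℝ} (hr : 0 < r)
    (h : ∀ x : UnitSphere m, (ψ x : EuclideanSpace ℝ (Fin (n + 1))) = φ (r • x.1))
    (f : UnitSphere n → ℝ) : radialExtension (f ∘ ψ) = radialExtension f ∘ φ := by
  ext x
  by_cases hx : x = 0
  · have h0 : φ 0 = 0 := by simpa using hφ 0 0
    simp [hx, h0, radialExtension]
  · have hx' : 0 < ‖x‖ := norm_pos_iff.2 hx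
    rw [radialExtension_of_ne_zero _ hx, Function.comp_apply, ← radialExtension_coe f, h, hφ, hφ,
      radialExtension_smul f (by positivity), radialExtension_smul f (by positivity),
      Function.comp_apply]

/-- A harmonic morphism which is homogeneous of degree two and maps the sphere of radius `r` into
the unit sphere restricts to a harmonic morphism of unit spheres. -/
theorem IsHarmonicMorphism.isSphereHarmonicMorphism {m : ℕ} {ψ : UnitSphere m → UnitSphere n}
    {φ : EuclideanSpace ℝ (Fin (m + 1)) → EuclideanSpace ℝ (Fin (n + 1))}
    (hm : IsHarmonicMorphism φ) (hφ : ∀ (t : ℝ) x, φ (t • x) = t ^ 2 • φ x) {r : ℝ} (hr : 0 < r)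
    (h : ∀ x : UnitSphere m, (ψ x : EuclideanSpace ℝ (Fin (n + 1))) = φ (r • x.1)) :
    IsSphereHarmonicMorphism ψ := by
  refine ⟨contMDiff_unitSphere_of_contDiff (hm.1.comp (contDiff_const_smul r)) h,
    fun V f _ hf x hx => ?_⟩
  have hψ := hf _ hx
  -- The radial extension is harmonic at `r ^ 2 • φ x`; its invariance under scaling moves this to
  -- `φ x`.
  rw [h, hφ] at hψ
  have hF : (fun y => radialExtension f (r ^ 2 • y)) = radialExtension f := by
    ext1 y
    exact radialExtension_smul f (by positivity) y
  have h1 := hψ.comp_smul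
  rw [hF] at h1
  rw [radialExtension_comp hφ hr h]
  -- The morphism property is applied on the open set of all points where the radial extension is
  -- harmonic.
  exact hm.2 _ _ (isOpen_setOfPred_harmonicAt _) (fun _ hy => hy) _ h1

end Sphere

theorem cliffordMap_smul {k d : ℕ} (P : Fin k → End ℝ (EuclideanSpace ℝ (Fin d))) (t : ℝ)
    (x : EuclideanSpace ℝ (Fin d)) : cliffordMap P (t • x) = t ^ 2 • cliffordMap P x := by
  ext i
  simp [cliffordMap, real_inner_smul_left, real_inner_smul_right]
  ring

/-- The isometry of the unit sphere induced by a linear isometry. -/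
noncomputable def LinearIsometryEquiv.unitSphere {n : ℕ}
    (A : EuclideanSpace ℝ (Fin (n + 1)) ≃ₗᵢ[ℝ] EuclideanSpace ℝ (Fin (n + 1))) :
    UnitSphere n ≃ᵢ UnitSphere n where
  toFun x := ⟨A x, by simp⟩
  invFun x := ⟨A.symm x, by simp⟩
  left_inv x := by simp
  right_inv x := by simp
  isometry_toFun := Isometry.of_dist_eq fun x y => A.dist_map x y

theorem corollary3p6 :
    -- After a homothety, each quadratic harmonic morphism comes from an irreducible Clifford
    -- system and restricts to a harmonic morphism bi-equivalent to the Hopf fibration.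
    (∀ φ : EuclideanSpace ℝ (Fin 4) → EuclideanSpace ℝ (Fin 3),
      IsQuadraticHarmonicMorphism φ →
      ∃ r : ℝ, 0 < r ∧
        (∃ P : Fin 3 → Module.End ℝ (EuclideanSpace ℝ (Fin 4)),
          IsCliffordSystem P ∧ IsIrreducibleSystem P ∧ ∀ x, φ (r • x) = cliffordMap P x) ∧
        ∃ ψ : UnitSphere 3 → UnitSphere 2,
          (∀ x : UnitSphere 3,
            (ψ x : EuclideanSpace ℝ (Fin 3)) = φ (r • (x : EuclideanSpace ℝ (Fin 4)))) ∧
          IsSphereHarmonicMorphism ψ ∧ BiEquivalent ψ hopfFibration) ∧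
    -- The Clifford systems that occur are all algebraically equivalent.
    (∀ φ φ' : EuclideanSpace ℝ (Fin 4) → EuclideanSpace ℝ (Fin 3),
      IsQuadraticHarmonicMorphism φ → IsQuadraticHarmonicMorphism φ' →
      ∀ r r' : ℝ, 0 < r → 0 < r' →
      ∀ P P' : Fin 3 → Module.End ℝ (EuclideanSpace ℝ (Fin 4)),
        IsCliffordSystem P → IsCliffordSystem P' →
        (∀ x, φ (r • x) = cliffordMap P x) → (∀ x, φ' (r' • x) = cliffordMap P' x) →
        AlgebraicallyEquivalent P P') := by
  refine ⟨fun φ hφ => ?_, fun _ _ _ _ _ _ _ _ P P' hP hP' _ _ =>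
    hP.algebraicallyEquivalent_hopfSystem.symm.trans hP'.algebraicallyEquivalent_hopfSystem⟩
  obtain ⟨r, hr, P, hP, hφP⟩ := hφ.exists_cliffordSystem
  obtain ⟨A, hA⟩ := hP.algebraicallyEquivalent_hopfSystem.exists_cliffordMap_eq
  have hφA (x : EuclideanSpace ℝ (Fin 4)) : φ (r • x) = hopfMap (A x) := by
    rw [hφP, hA, cliffordMap_hopfSystem]
  have hsmul (t : ℝ) (x : EuclideanSpace ℝ (Fin 4)) : φ (t • x) = t ^ 2 • φ x := by
    have h (y : EuclideanSpace ℝ (Fin 4)) : φ y = cliffordMap P (r⁻¹ • y) := by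
      rw [← hφP, smul_inv_smul₀ hr.ne']
    rw [h, h, smul_comm, cliffordMap_smul]
  have hψ (x : UnitSphere 3) :
      ((hopfFibration ∘ A.unitSphere) x : EuclideanSpace ℝ (Fin 3)) = φ (r • x.1) :=
    (hφA x).symm
  exact ⟨r, hr, ⟨P, hP, hP.isIrreducibleSystem, hφP⟩, hopfFibration ∘ A.unitSphere, hψ,
    hφ.isHarmonicMorphism.isSphereHarmonicMorphism hsmul hr hψ,
    -- The orthogonal change of frame on `S³` suffices; no isometry of `S²` is needed.
    A.unitSphere, IsometryEquiv.refl _, rfl⟩
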